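/- Let $k$ be an algebraically closed field, let $Q$ be a finite connected quiver with vertex set $Q_0$, $|Q_0|=n$, and let $I$ be a set of elements of the path algebra $kQ$, each of which is a $k$-linear combination of paths of one and the same length. Let $\langle I\rangle$ be the two-sided ideal generated by $I$, and suppose that $\langle I\rangle\subseteq J^2$, where $J$ is the two-sided ideal of $kQ$ generated by the arrows, and that $A=kQ/\langle I\rangle$ is finite-dimensional over $k$. (Thus $(Q,I)$ is a connected homogeneous bound quiver.) Grade $A$ by path length, let $e_i\in A$ be the class of the trivial path at the vertex $i$, and let $C_q=(c_{ij}(q))_{i,j\in Q_0}$ be the $q$-Cartan matrix of $(Q,I)$, where $$c_{ij}(q)=\sum_{m\ge 0}\dim_k\,(e_iAe_j)_m\,q^m\in\mathbb Z[q].$$ If $A$ has finite global dimension, then $\det C_q\in\{1,-1\}$. In particular, $$C_q\in GL(n,\mathbb Z[q])=\{M\in M_n(\mathbb Z[q])\mid \det M\in\{1,-1\}\}.$$ -/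

import Mathlib

open Polynomial

universe u v w

section PathAlgebra

variable (k : Type u) [Field k] (Q : Type v) [Quiver.{w} Q]

/-- An oriented path in the quiver `Q`, together with its start vertex and its end vertex. -/
structure OrientedPath where
  source : Q
  target : Q
  path : Quiver.Path source target

/-- The underlying vector space of the path algebra `k Q`: the space with basis the set of all
oriented paths, including the trivial path at each vertex. -/
def PathAlgebra : Type (max u v w) := OrientedPath Q →₀ k

namespace PathAlgebra

noncomputable instance : AddCommGroup (PathAlgebra k Q) :=
  inferInstanceAs (AddCommGroup (OrientedPath Q →₀ k))

noncomputable instance : Module k (PathAlgebra k Q) :=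
  inferInstanceAs (Module k (OrientedPath Q →₀ k))

variable {Q}

/-- The basis element of the path algebra given by an oriented path. -/
noncomputable def ofPath (p : OrientedPath Q) : PathAlgebra k Q :=
  (Finsupp.single p 1 : OrientedPath Q →₀ k)

variable {k}

/-- The set of paths occurring in an element with a nonzero coefficient. -/
def support (x : PathAlgebra k Q) : Finset (OrientedPath Q) :=
  Finsupp.support (show OrientedPath Q →₀ k from x)

variable (k)

theorem hom_ext {M : Type*} [AddCommMonoid M] [Module k M] {f g : PathAlgebra k Q →ₗ[k] M}
    (h : ∀ p, f (ofPath k p) = g (ofPath k p)) : f = g :=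
  Finsupp.lhom_ext' (R := k) fun p => LinearMap.ext_ring (h p)

/-- The linear extension of a function given on paths. -/
noncomputable def lift {M : Type*} [AddCommMonoid M] [Module k M] (f : OrientedPath Q → M) :
    PathAlgebra k Q →ₗ[k] M :=
  Finsupp.linearCombination k f

@[simp]
theorem lift_ofPath {M : Type*} [AddCommMonoid M] [Module k M] (f : OrientedPath Q → M)
    (p : OrientedPath Q) : lift k f (ofPath k p) = f p :=
  (Finsupp.linearCombination_single k (1 : k) p).trans (one_smul k _)

/-- The trivial path at a vertex, as an element of the path algebra. -/
noncomputable def vertex (a : Q) : PathAlgebra k Q := ofPath k ⟨a, a, Quiver.Path.nil⟩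

/-- An arrow, as an element of the path algebra. -/
noncomputable def arrow {a b : Q} (α : a ⟶ b) : PathAlgebra k Q := ofPath k ⟨a, b, α.toPath⟩

/-- The degree `n` part of the path algebra: the span of the paths of length `n`. -/
noncomputable def degreePart (Q : Type v) [Quiver.{w} Q] (n : ℕ) : Submodule k (PathAlgebra k Q) :=
  Submodule.span k {x | ∃ p : OrientedPath Q, p.path.length = n ∧ x = ofPath k p}

/-- The projection of the path algebra onto its degree `n` part. -/
noncomputable def degreeProj (n : ℕ) : PathAlgebra k Q →ₗ[k] PathAlgebra k Q :=
  lift k fun p => if p.path.length = n then ofPath k p else 0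

theorem degreeProj_of_mem {m n : ℕ} {x : PathAlgebra k Q} (hx : x ∈ degreePart k Q n) :
    degreeProj k m x = if n = m then x else 0 := by
  induction hx using Submodule.span_induction with
  | mem x hx =>
    obtain ⟨p, rfl, rfl⟩ := hx
    simp [degreeProj]
  | zero => simp
  | add x y _ _ hx hy => rw [map_add, hx, hy]; split_ifs <;> simp
  | smul a x _ hx => rw [map_smul, hx]; split_ifs <;> simp

theorem mem_span_ofPath_support (x : PathAlgebra k Q) :
    x ∈ Submodule.span k (ofPath k '' (x.support : Set (OrientedPath Q))) := by
  have h : (Finsupp.sum (show OrientedPath Q →₀ k from x) fun p a => a • ofPath k p) = x :=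
    (Finset.sum_congr rfl fun p _ => Finsupp.smul_single_one p _).trans (Finsupp.sum_single _)
  have h2 : (Finsupp.sum (show OrientedPath Q →₀ k from x) fun p a => a • ofPath k p) ∈
      Submodule.span k (ofPath k '' (x.support : Set (OrientedPath Q))) :=
    Submodule.sum_mem _ fun p hp =>
      Submodule.smul_mem _ _ (Submodule.subset_span ⟨p, hp, rfl⟩)
  rwa [h] at h2

theorem mem_degreePart {n : ℕ} {x : PathAlgebra k Q}
    (hx : ∀ p ∈ x.support, p.path.length = n) : x ∈ degreePart k Q n := by
  refine Submodule.span_mono ?_ (mem_span_ofPath_support k x)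
  rintro _ ⟨p, hp, rfl⟩
  exact ⟨p, hx p hp, rfl⟩

theorem induction {C : PathAlgebra k Q → Prop} (h0 : C 0) (ha : ∀ x y, C x → C y → C (x + y))
    (hs : ∀ (a : k) (p : OrientedPath Q), C (a • ofPath k p)) (x : PathAlgebra k Q) : C x := by
  refine Finsupp.induction_linear (motive := C) (show OrientedPath Q →₀ k from x) h0 ha ?_
  intro p a
  have := hs a p
  rwa [show a • ofPath k p = (Finsupp.single p a : OrientedPath Q →₀ k) from
    Finsupp.smul_single_one p a] at this

variable [DecidableEq Q]

/-- The product of two paths: their concatenation `p q` if the end vertex of `p` is the start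
vertex of `q`, and zero otherwise. -/
noncomputable def pathMul (p q : OrientedPath Q) : PathAlgebra k Q :=
  if h : q.source = p.target then ofPath k ⟨p.source, q.target, p.path.comp (q.path.cast h rfl)⟩
  else 0

/-- The bilinear extension of the product of paths. -/
noncomputable def mulHom : PathAlgebra k Q →ₗ[k] PathAlgebra k Q →ₗ[k] PathAlgebra k Q :=
  lift k fun p => lift k fun q => pathMul k p q

noncomputable instance : Mul (PathAlgebra k Q) := ⟨fun x y => mulHom k x y⟩

theorem mul_def (x y : PathAlgebra k Q) : x * y = mulHom k x y := rfl

theorem ofPath_mul (p q : OrientedPath Q) : ofPath k p * ofPath k q = pathMul k p q := by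
  simp [mul_def, mulHom]

theorem ofPath_mul_comp {a b c : Q} (p : Quiver.Path a b) (q : Quiver.Path b c) :
    ofPath k ⟨a, b, p⟩ * ofPath k ⟨b, c, q⟩ = ofPath k ⟨a, c, p.comp q⟩ := by
  simp [ofPath_mul, pathMul]

theorem ofPath_mul_of_ne {p q : OrientedPath Q} (h : q.source ≠ p.target) :
    ofPath k p * ofPath k q = 0 := by
  simp [ofPath_mul, pathMul, h]

protected theorem mul_assoc (x y z : PathAlgebra k Q) : x * y * z = x * (y * z) := by
  have key : ∀ p q r : OrientedPath Q,
      ofPath k p * ofPath k q * ofPath k r = ofPath k p * (ofPath k q * ofPath k r) := by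
    rintro ⟨a, b, p⟩ ⟨b', c, q⟩ ⟨c', d, r⟩
    by_cases h1 : b' = b
    · subst h1
      rw [ofPath_mul_comp]
      by_cases h2 : c' = c
      · subst h2
        simp [ofPath_mul_comp]
      · rw [ofPath_mul_of_ne k h2, ofPath_mul_of_ne k h2]
        simp [mul_def]
    · rw [ofPath_mul_of_ne k h1]
      by_cases h2 : c' = c
      · subst h2
        rw [ofPath_mul_comp, ofPath_mul_of_ne k h1]
        simp [mul_def]
      · rw [ofPath_mul_of_ne k h2]
        simp [mul_def]
  have h : (LinearMap.llcomp k (PathAlgebra k Q) (PathAlgebra k Q) (PathAlgebra k Q) ∘ₗ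
        mulHom k).flip ∘ₗ mulHom k =
      ((LinearMap.llcomp k (PathAlgebra k Q) (PathAlgebra k Q)
        (PathAlgebra k Q →ₗ[k] PathAlgebra k Q) (mulHom k)) ∘ₗ mulHom k).flip := by
    apply hom_ext k
    intro q
    apply hom_ext k
    intro p
    apply hom_ext k
    intro r
    exact (key p q r).symm
  exact (LinearMap.congr_fun (LinearMap.congr_fun (LinearMap.congr_fun h y) x) z).symm

variable [Fintype Q]

/-- The unit of the path algebra is the sum of the trivial paths. -/
noncomputable instance : One (PathAlgebra k Q) := ⟨∑ a : Q, vertex k a⟩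

protected theorem one_mul (x : PathAlgebra k Q) : 1 * x = x := by
  have h : mulHom k (1 : PathAlgebra k Q) = LinearMap.id := by
    apply hom_ext k
    rintro ⟨a, b, p⟩
    rw [show (1 : PathAlgebra k Q) = ∑ a : Q, vertex k a from rfl, map_sum, LinearMap.sum_apply, Finset.sum_eq_single a]
    · simpa [vertex] using! ofPath_mul_comp k (Quiver.Path.nil : Quiver.Path a a) p
    · intro c _ hc
      exact ofPath_mul_of_ne k (p := ⟨c, c, Quiver.Path.nil⟩) (q := ⟨a, b, p⟩) (Ne.symm hc)
    · simp
  exact LinearMap.congr_fun h x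

protected theorem mul_one (x : PathAlgebra k Q) : x * 1 = x := by
  have h : (mulHom k).flip (1 : PathAlgebra k Q) = LinearMap.id := by
    apply hom_ext k
    rintro ⟨a, b, p⟩
    rw [show (1 : PathAlgebra k Q) = ∑ a : Q, vertex k a from rfl, map_sum, LinearMap.sum_apply, Finset.sum_eq_single b]
    · exact ofPath_mul_comp k p (Quiver.Path.nil : Quiver.Path b b)
    · intro c _ hc
      exact ofPath_mul_of_ne k (p := ⟨a, b, p⟩) (q := ⟨c, c, Quiver.Path.nil⟩) hc
    · simp
  exact LinearMap.congr_fun h x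

noncomputable instance : Ring (PathAlgebra k Q) :=
  { (inferInstance : AddCommGroup (PathAlgebra k Q)) with
    mul := (· * ·)
    one := 1
    left_distrib := fun x y z => by simp [mul_def]
    right_distrib := fun x y z => by simp [mul_def]
    zero_mul := fun x => by simp [mul_def]
    mul_zero := fun x => by simp [mul_def]
    mul_assoc := PathAlgebra.mul_assoc k
    one_mul := PathAlgebra.one_mul k
    mul_one := PathAlgebra.mul_one k }

noncomputable instance : Algebra k (PathAlgebra k Q) :=
  Algebra.ofModule (fun r x y => by simp [mul_def]) (fun r x y => by simp [mul_def])

variable (Q)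

/-- The two-sided ideal of the path algebra generated by the arrows. -/
noncomputable def arrowIdeal : TwoSidedIdeal (PathAlgebra k Q) :=
  TwoSidedIdeal.span {x | ∃ (a b : Q) (α : a ⟶ b), x = arrow k α}

variable {Q}

theorem degreeProj_ofPath_mul (n : ℕ) (p : OrientedPath Q) (y : PathAlgebra k Q) :
    degreeProj k n (ofPath k p * y) =
      if p.path.length ≤ n then ofPath k p * degreeProj k (n - p.path.length) y else 0 := by
  induction y using induction k with
  | h0 => simp
  | ha x y hx hy => rw [mul_add, map_add, hx, hy]; split_ifs <;> simp [mul_add]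
  | hs a q =>
    obtain ⟨i, j, p⟩ := p
    obtain ⟨i', l, q⟩ := q
    by_cases h : i' = j
    · subst h
      rw [mul_smul_comm, ofPath_mul_comp]
      by_cases h1 : p.length ≤ n
      · by_cases h2 : q.length = n - p.length
        · have h3 : p.length + q.length = n := by omega
          simp [degreeProj, h1, h2, ofPath_mul_comp]
        · have h3 : p.length + q.length ≠ n := by omega
          simp [degreeProj, h2, h3]
      · have h3 : p.length + q.length ≠ n := by omega
        simp [degreeProj, h1, h3]
    · have h0 : ofPath k ⟨i, j, p⟩ * ofPath k ⟨i', l, q⟩ = 0 := ofPath_mul_of_ne k h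
      rw [mul_smul_comm, h0]
      simp only [smul_zero, map_zero, map_smul, degreeProj, lift_ofPath]
      split_ifs <;> simp [h0]

theorem degreeProj_mul_ofPath (n : ℕ) (p : OrientedPath Q) (y : PathAlgebra k Q) :
    degreeProj k n (y * ofPath k p) =
      if p.path.length ≤ n then degreeProj k (n - p.path.length) y * ofPath k p else 0 := by
  induction y using induction k with
  | h0 => simp
  | ha x y hx hy => rw [add_mul, map_add, hx, hy]; split_ifs <;> simp [add_mul]
  | hs a q =>
    obtain ⟨i, j, p⟩ := p
    obtain ⟨l, i', q⟩ := q
    by_cases h : i = i'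
    · subst h
      rw [smul_mul_assoc, ofPath_mul_comp]
      by_cases h1 : p.length ≤ n
      · by_cases h2 : q.length = n - p.length
        · have h3 : q.length + p.length = n := by omega
          simp [degreeProj, h1, h2, ofPath_mul_comp]
        · have h3 : q.length + p.length ≠ n := by omega
          simp [degreeProj, h2, h3]
      · have h3 : q.length + p.length ≠ n := by omega
        simp [degreeProj, h1, h3]
    · have h0 : ofPath k ⟨l, i', q⟩ * ofPath k ⟨i, j, p⟩ = 0 := ofPath_mul_of_ne k h
      rw [smul_mul_assoc, h0]
      simp only [smul_zero, map_zero, map_smul, degreeProj, lift_ofPath]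
      split_ifs <;> simp [h0]

/-- An ideal generated by homogeneous elements is closed under taking homogeneous components. -/
theorem degreeProj_mem_span {s : Set (PathAlgebra k Q)}
    (hs : ∀ x ∈ s, ∃ n : ℕ, ∀ p ∈ x.support, p.path.length = n) {x : PathAlgebra k Q}
    (hx : x ∈ TwoSidedIdeal.span s) (n : ℕ) : degreeProj k n x ∈ TwoSidedIdeal.span s := by
  have hsmul : ∀ (a : k) {y : PathAlgebra k Q}, y ∈ TwoSidedIdeal.span s →
      a • y ∈ TwoSidedIdeal.span s := fun a y hy => by
    rw [Algebra.smul_def]; exact TwoSidedIdeal.mul_mem_left _ _ _ hy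
  let T : TwoSidedIdeal (PathAlgebra k Q) := TwoSidedIdeal.mk'
    {x | ∀ n, degreeProj k n x ∈ TwoSidedIdeal.span s}
    (fun n => by rw [map_zero]; exact TwoSidedIdeal.zero_mem _)
    (fun hx hy n => by rw [map_add]; exact TwoSidedIdeal.add_mem _ (hx n) (hy n))
    (fun hx n => by rw [map_neg]; exact TwoSidedIdeal.neg_mem _ (hx n))
    (fun {x y} hy n => by
      induction x using induction k generalizing n with
      | h0 => rw [zero_mul, map_zero]; exact TwoSidedIdeal.zero_mem _
      | ha x y hx hy => rw [add_mul, map_add]; exact TwoSidedIdeal.add_mem _ (hx n) (hy n)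
      | hs a p =>
        rw [smul_mul_assoc, map_smul, degreeProj_ofPath_mul]
        apply hsmul
        split_ifs
        · exact TwoSidedIdeal.mul_mem_left _ _ _ (hy _)
        · exact TwoSidedIdeal.zero_mem _)
    (fun {x y} hx n => by
      induction y using induction k generalizing n with
      | h0 => rw [mul_zero, map_zero]; exact TwoSidedIdeal.zero_mem _
      | ha x y hx hy => rw [mul_add, map_add]; exact TwoSidedIdeal.add_mem _ (hx n) (hy n)
      | hs a p =>
        rw [mul_smul_comm, map_smul, degreeProj_mul_ofPath]
        apply hsmul
        split_ifs
        · exact TwoSidedIdeal.mul_mem_right _ _ _ (hx _)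
        · exact TwoSidedIdeal.zero_mem _)
  have hT : TwoSidedIdeal.span s ≤ T := by
    rw [TwoSidedIdeal.span_le]
    intro x hx
    refine (TwoSidedIdeal.mem_mk' _ _ _ _ _ _ _).2 fun n => ?_
    obtain ⟨m, hm⟩ := hs x hx
    rw [degreeProj_of_mem k (mem_degreePart k hm)]
    split_ifs
    · exact TwoSidedIdeal.subset_span hx
    · exact TwoSidedIdeal.zero_mem _
  exact (TwoSidedIdeal.mem_mk' _ _ _ _ _ _ _).1 (hT hx) n

end PathAlgebra

end PathAlgebra

/-- The quiver `Q` is connected: it has a vertex, and any two vertices are joined by a walk in the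
underlying undirected graph. -/
def Quiver.IsConnected (Q : Type v) [Quiver.{w} Q] : Prop :=
  Nonempty Q ∧ Subsingleton (Quiver.WeaklyConnectedComponent Q)

/-- The (right) global dimension of a ring `A`: the supremum of the projective dimensions of the
right `A`-modules, that is, of the modules over the opposite ring. -/
noncomputable def rightGlobalDimension (A : Type u) [Ring A] : WithBot ℕ∞ :=
  ⨆ M : ModuleCat.{u} Aᵐᵒᵖ, CategoryTheory.projectiveDimension M

/-- A homogeneous bound quiver `(Q, I)` over `k`, on a finite quiver `Q`: a set `I` of linear
combinations of paths of the same length, such that the ideal `⟨I⟩` of `k Q` is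
admissible (`⟨I⟩ ⊆ J * J`, with `J` the ideal generated by the arrows) and the
algebra `k Q / ⟨I⟩` is finite-dimensional. -/
structure HomogeneousBoundQuiver (k : Type u) [Field k] (Q : Type v) [Quiver.{w} Q] [Fintype Q]
    [DecidableEq Q] where
  /-- The set `I` of relations. -/
  relations : Set (PathAlgebra k Q)
  homogeneous : ∀ x ∈ relations, ∃ n : ℕ, ∀ p ∈ x.support, p.path.length = n
  admissible : ∀ x ∈ TwoSidedIdeal.span relations,
    x ∈ (PathAlgebra.arrowIdeal k Q).asIdeal * (PathAlgebra.arrowIdeal k Q).asIdeal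
  finiteDimensional : FiniteDimensional k (TwoSidedIdeal.span relations).ringCon.Quotient

namespace HomogeneousBoundQuiver

variable {k : Type u} [Field k] {Q : Type v} [Quiver.{w} Q] [Fintype Q] [DecidableEq Q]
  (B : HomogeneousBoundQuiver k Q)

/-- The homogeneous bound quiver algebra `A = k Q / ⟨I⟩`. -/
abbrev algebra : Type (max u v w) := (TwoSidedIdeal.span B.relations).ringCon.Quotient

/-- The quotient map `k Q → A`. -/
noncomputable def proj : PathAlgebra k Q →ₗ[k] B.algebra where
  toFun := (TwoSidedIdeal.span B.relations).ringCon.mk'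
  map_add' := map_add _
  map_smul' _ _ := rfl

/-- The idempotent `e_i` of `A`. -/
noncomputable def e (i : Q) : B.algebra := B.proj (PathAlgebra.vertex k i)

/-- The degree `n` part `A_n` of `A`, for the grading inherited from the path length. -/
noncomputable def gradedPart (n : ℕ) : Submodule k B.algebra :=
  (PathAlgebra.degreePart k Q n).map B.proj

/-- The degree `n` part `(e_i A e_j)_n = e_i A_n e_j` of the graded vector space `e_i A e_j`. -/
noncomputable def peirceGradedPart (i j : Q) (n : ℕ) : Submodule k B.algebra :=
  (B.gradedPart n).map (LinearMap.mulLeft k (B.e i) ∘ₗ LinearMap.mulRight k (B.e j))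

/-- The `q`-Cartan matrix `C_q = (c_ij(q))`, with entries the Poincaré polynomials
`c_ij(q) = ∑_n dim_k (e_i A e_j)_n q^n` in `ℤ[q]`. -/
noncomputable def qCartanMatrix : Matrix Q Q ℤ[X] := fun i j =>
  ∑ᶠ n : ℕ, (Module.finrank k (B.peirceGradedPart i j n) : ℤ[X]) * X ^ n

theorem proj_eq_zero_iff (x : PathAlgebra k Q) :
    B.proj x = 0 ↔ x ∈ TwoSidedIdeal.span B.relations :=
  (RingCon.eq (TwoSidedIdeal.span B.relations).ringCon (a := x) (b := 0))

/-- Only finitely many degrees of `A` are nonzero. -/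
theorem finite_gradedPart_ne_bot : {n | B.gradedPart n ≠ ⊥}.Finite := by
  have hex : ∀ n : {n | B.gradedPart n ≠ ⊥},
      ∃ x ∈ PathAlgebra.degreePart k Q n, B.proj x ≠ 0 := by
    rintro ⟨n, hn⟩
    obtain ⟨_, ⟨x, hx, rfl⟩, h0⟩ := (Submodule.ne_bot_iff _).1 hn
    exact ⟨x, hx, h0⟩
  choose a ha ha0 using hex
  have hli : LinearIndependent k fun n => B.proj (a n) := by
    rw [linearIndependent_iff']
    intro s g hg m hm
    have h1 : B.proj (∑ n ∈ s, g n • a n) = 0 := by simpa using hg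
    have h2 := PathAlgebra.degreeProj_mem_span k B.homogeneous
      ((B.proj_eq_zero_iff _).1 h1) (m : ℕ)
    rw [map_sum, Finset.sum_eq_single m, map_smul, PathAlgebra.degreeProj_of_mem k (ha m),
      if_pos rfl, ← B.proj_eq_zero_iff, map_smul] at h2
    · exact (smul_eq_zero.1 h2).resolve_right (ha0 m)
    · intro n _ hn
      rw [map_smul, PathAlgebra.degreeProj_of_mem k (ha n),
        if_neg fun h => hn (Subtype.ext h), smul_zero]
    · exact fun h => absurd hm h
  have := B.finiteDimensional
  have := hli.finite
  exact Set.toFinite _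

/-- The sum defining an entry of `C_q` is finite, so that its coefficient in degree `n` is indeed
the dimension of `(e_i A e_j)_n`. -/
theorem coeff_qCartanMatrix (i j : Q) (n : ℕ) :
    (B.qCartanMatrix i j).coeff n = Module.finrank k (B.peirceGradedPart i j n) := by
  have hbot : ∀ n, B.gradedPart n = ⊥ → B.peirceGradedPart i j n = ⊥ := by
    intro n h
    rw [peirceGradedPart, h, Submodule.map_bot]
  have hsub : (Function.support fun n : ℕ =>
      (Module.finrank k (B.peirceGradedPart i j n) : ℤ[X]) * X ^ n) ⊆
        B.finite_gradedPart_ne_bot.toFinset := by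
    intro n hn
    rw [Set.Finite.coe_toFinset]
    intro h
    apply hn
    beta_reduce
    rw [hbot n h, finrank_bot, Nat.cast_zero, zero_mul]
  have h0 : n ∉ B.finite_gradedPart_ne_bot.toFinset →
      Module.finrank k (B.peirceGradedPart i j n) = 0 := by
    intro h
    have h' : B.gradedPart n = ⊥ := by
      by_contra hne
      exact h (B.finite_gradedPart_ne_bot.mem_toFinset.2 hne)
    rw [hbot n h', finrank_bot]
  rw [qCartanMatrix, finsum_eq_sum_of_support_subset _ hsub, Polynomial.finsetSum_coeff]
  simp only [← Polynomial.C_eq_natCast, Polynomial.coeff_C_mul_X_pow]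
  rw [Finset.sum_ite_eq]
  split_ifs with h
  · simp
  · simp [h0 h]

end HomogeneousBoundQuiver

/-! Row `i` of `C_q` is the vector of Hilbert series of the graded right module `e_i A`, one series
per vertex. The matrix is invertible as soon as every standard basis vector is a `ℤ[q]`-combination
of its rows. The basis vector at `i` is the Hilbert series of the simple module at `i` in degree 0,
which is that of `e_i A` minus that of its radical (`hilbertSeries_vertexRadical`). So it is enough
that the Hilbert series of the radical lies in the row span.

This holds for every homogeneous submodule `M` of a finite sum of shifted copies of `A` whose
projective dimension is finite (`hilbertSeries_mem_cartanSpan`). Homogeneous generators give an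
exact sequence from the syzygy through a sum of shifted modules `e_v A` onto `M`. Hilbert series are
additive on it, the middle term lies in the row span, and the syzygy has smaller projective
dimension. The induction stops at projective `M`: a minimal homogeneous generating set then has no
syzygies, by a Nakayama argument (`exists_minimal_generators`, `syzygy_eq_bot`). Projectivity is
used only as an ungraded property, so the usual global dimension suffices.

The coefficients found in this way form a left inverse of `C_q` over `ℤ[q]`. Hence `det C_q` is a
unit of `ℤ[q]`, that is, `1` or `-1`. The argument is carried out for an abstract `VertexGrading`,
which the path-length grading of the bound quiver algebra then instantiates. -/

/-! ### Graded algebras with vertex idempotents, and degree shifts -/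

/-- A grading of a `k`-algebra `A` by the natural numbers, given by its family of projections,
together with a complete family of nonzero orthogonal idempotents spanning the degree zero part. -/
structure VertexGrading (k : Type*) (A : Type*) (Q : Type*) [Field k] [Ring A] [Algebra k A]
    [Fintype Q] [DecidableEq Q] where
  /-- The idempotent at a vertex. -/
  e : Q → A
  /-- The projection onto a homogeneous part. -/
  π : ℕ → A →ₗ[k] A
  e_mul_e : ∀ i j, e i * e j = if i = j then e i else 0
  sum_e : ∑ i, e i = 1
  e_ne_zero : ∀ i, e i ≠ 0
  proj_e : ∀ i, π 0 (e i) = e i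
  proj_proj : ∀ m n x, π m (π n x) = if m = n then π n x else 0
  exists_sum_proj : ∃ N, ∀ x, ∑ n ∈ Finset.range N, π n x = x
  proj_mul : ∀ m n x y, π n (π m x * y) = if m ≤ n then π m x * π (n - m) y else 0
  proj_mul_e : ∀ n x i, π n (x * e i) = π n x * e i
  proj_zero : ∀ x i, e i * x = x → ∃ c : k, π 0 x = c • e i

namespace VertexGrading

variable {k A Q : Type*} [Field k] [Ring A] [Algebra k A] [Fintype Q] [DecidableEq Q]
  (G : VertexGrading k A Q)

theorem e_mul_self (i : Q) : G.e i * G.e i = G.e i := by simp [G.e_mul_e]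

theorem proj_e_mul (n : ℕ) (i : Q) (x : A) : G.π n (G.e i * x) = G.e i * G.π n x := by
  have := G.proj_mul 0 n (G.e i) x
  simpa [G.proj_e] using this

/-- The projection onto degree `n` of the graded module obtained from `A` by a shift by `d`. -/
noncomputable def shift (d n : ℕ) : A →ₗ[k] A := if d ≤ n then G.π (n - d) else 0

theorem shift_apply (d n : ℕ) (x : A) : G.shift d n x = if d ≤ n then G.π (n - d) x else 0 := by
  unfold shift; split_ifs <;> simp

theorem shift_shift (d m n : ℕ) (x : A) :
    G.shift d m (G.shift d n x) = if m = n then G.shift d n x else 0 := by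
  simp only [shift_apply]
  by_cases h1 : d ≤ m <;> by_cases h2 : d ≤ n <;> simp [h1, h2, G.proj_proj]
  · have : (m - d = n - d) ↔ m = n := by omega
    simp [this]
  · rintro rfl; exact absurd h2 h1

/-- In the copy shifted by `d`, an element `y` of degree `m` gives a degree-preserving map from the
copy shifted by `m`. This is what makes `combination` a graded homomorphism. -/
theorem shift_mul (d m n : ℕ) {y : A} (hy : G.shift d m y = y) (a : A) :
    G.shift d n (y * a) = y * G.shift m n a := by
  simp only [shift_apply] at hy ⊢
  by_cases h1 : d ≤ m
  · rw [if_pos h1] at hy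
    have := G.proj_mul (m - d) (n - d) y a
    rw [hy] at this
    by_cases h2 : d ≤ n
    · rw [if_pos h2, this]
      by_cases h3 : m ≤ n
      · rw [if_pos h3, if_pos (by omega), show n - d - (m - d) = n - m by omega]
      · rw [if_neg h3, if_neg (by omega), mul_zero]
    · rw [if_neg h2, if_neg (by omega), mul_zero]
  · rw [if_neg h1] at hy
    simp [← hy]

theorem shift_mul_e (d n : ℕ) (x : A) (i : Q) :
    G.shift d n (x * G.e i) = G.shift d n x * G.e i := by
  simp only [shift_apply]; split_ifs <;> simp [G.proj_mul_e]

theorem shift_e_mul (d n : ℕ) (i : Q) (x : A) :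
    G.shift d n (G.e i * x) = G.e i * G.shift d n x := by
  simp only [shift_apply]; split_ifs <;> simp [G.proj_e_mul]

theorem exists_sum_shift (D : ℕ) :
    ∃ N, ∀ d ≤ D, ∀ x, ∑ n ∈ Finset.range N, G.shift d n x = x := by
  obtain ⟨N, hN⟩ := G.exists_sum_proj
  have hz : ∀ n, N ≤ n → ∀ x, G.π n x = 0 := fun n hn x => by
    rw [← hN x, map_sum]
    refine Finset.sum_eq_zero fun m hm => ?_
    rw [G.proj_proj, if_neg]
    rw [Finset.mem_range] at hm; omega
  -- A shift by `d ≤ D` puts `A` in degrees from `d` to `d + N - 1`, so `D + N` serves all these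
  -- shifts at once.
  refine ⟨D + N, fun d hd x => ?_⟩
  have h1 : ∑ n ∈ Finset.range (d + (D - d + N)), G.shift d n x =
      ∑ n ∈ Finset.range (D - d + N), G.π n x := by
    rw [Finset.sum_range_add, Finset.sum_eq_zero, zero_add]
    · refine Finset.sum_congr rfl fun n _ => ?_
      simp [shift_apply]
    · intro n hn
      rw [Finset.mem_range] at hn
      rw [shift_apply, if_neg (by omega)]
  rw [show D + N = d + (D - d + N) by omega, h1, add_comm, Finset.sum_range_add, hN,
    Finset.sum_eq_zero, add_zero]
  intro n _
  exact hz _ (by omega) _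

theorem proj_eq_zero_of_forall {x : A} (h : ∀ n, G.π n x = 0) : x = 0 := by
  obtain ⟨N, hN⟩ := G.exists_sum_proj
  rw [← hN x]
  exact Finset.sum_eq_zero fun n _ => h n

/-- Right multiplication by an element without degree 0 part raises the lowest degree by at least
one; this drives the Nakayama argument in `syzygy_eq_bot`. -/
theorem proj_mul_eq_zero {m : ℕ} {a b : A} (ha : ∀ n < m, G.π n a = 0) (hb : G.π 0 b = 0) :
    ∀ n < m + 1, G.π n (a * b) = 0 := by
  intro n hn
  obtain ⟨N, hN⟩ := G.exists_sum_proj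
  rw [← hN a, Finset.sum_mul, map_sum]
  refine Finset.sum_eq_zero fun p _ => ?_
  rw [G.proj_mul]
  split_ifs with h
  · by_cases hp : p < m
    · rw [ha p hp, zero_mul]
    · rw [show n - p = 0 by omega, hb, mul_zero]
  · rfl

/-! ### Homogeneous submodules of sums of shifted copies of `A` -/

section Component

variable {T : Type*} (deg : T → ℕ)

/-- The projection of the sum of shifted copies of `A` onto degree `n` at the vertex `j`. -/
noncomputable def component (n : ℕ) (j : Q) : (T → A) →ₗ[k] (T → A) :=
  LinearMap.pi fun t => LinearMap.mulRight k (G.e j) ∘ₗ G.shift (deg t) n ∘ₗ LinearMap.proj t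

theorem component_apply (n : ℕ) (j : Q) (x : T → A) (t : T) :
    G.component deg n j x t = G.shift (deg t) n (x t) * G.e j := rfl

theorem component_component (m n : ℕ) (i j : Q) (x : T → A) :
    G.component deg m i (G.component deg n j x) =
      if m = n ∧ i = j then G.component deg n j x else 0 := by
  ext t
  rw [component_apply, component_apply, shift_mul_e, shift_shift, mul_assoc, G.e_mul_e]
  by_cases h1 : m = n
  · by_cases h2 : i = j
    · simp [h1, h2, component_apply]
    · simp [h1, h2, Ne.symm h2]
  · simp [h1]

theorem exists_sum_component [Finite T] :
    ∃ N, ∀ x, ∑ n ∈ Finset.range N, ∑ j, G.component deg n j x = x := by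
  cases nonempty_fintype T
  obtain ⟨N, hN⟩ := G.exists_sum_shift (Finset.univ.sup deg)
  refine ⟨N, fun x => funext fun t => ?_⟩
  simp only [Finset.sum_apply, component_apply, ← Finset.mul_sum, G.sum_e, mul_one]
  exact hN _ (Finset.le_sup (Finset.mem_univ t)) _

/-- A right submodule of a sum of shifted copies of `A` is homogeneous. -/
def IsHomogeneous (M : Submodule Aᵐᵒᵖ (T → A)) : Prop :=
  ∀ n j, ∀ x ∈ M, G.component deg n j x ∈ M

/-- The degree `n` part of `M` at the vertex `j`. -/
noncomputable def piece (M : Submodule Aᵐᵒᵖ (T → A)) (n : ℕ) (j : Q) : Submodule k (T → A) :=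
  M.restrictScalars k ⊓ LinearMap.eqLocus (G.component deg n j) LinearMap.id

theorem mem_piece {M : Submodule Aᵐᵒᵖ (T → A)} {n : ℕ} {j : Q} {x : T → A} :
    x ∈ G.piece deg M n j ↔ x ∈ M ∧ G.component deg n j x = x := Iff.rfl

/-- The Hilbert series of `M` at the vertex `j`. -/
noncomputable def hilbertSeries (M : Submodule Aᵐᵒᵖ (T → A)) (j : Q) : PowerSeries ℤ :=
  PowerSeries.mk fun n => (Module.finrank k (G.piece deg M n j) : ℤ)

end Component

/-! ### Presentations by the modules `e_v A`, and their syzygies -/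

section Presentation

variable {T : Type*} {r : ℕ}

/-- The homomorphism of right modules sending the basis to the family `x`. -/
def combination (x : Fin r → T → A) : (Fin r → A) →ₗ[Aᵐᵒᵖ] (T → A) where
  toFun a := fun t => ∑ s, x s t * a s
  map_add' a b := by ext t; simp [mul_add, Finset.sum_add_distrib]
  map_smul' c a := by ext t; simp [Finset.sum_mul, mul_assoc]

theorem combination_apply (x : Fin r → T → A) (a : Fin r → A) (t : T) :
    combination x a t = ∑ s, x s t * a s := rfl

theorem combination_eq_sum (x : Fin r → T → A) (a : Fin r → A) :
    combination x a = ∑ s, MulOpposite.op (a s) • x s := by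
  ext t; simp [combination_apply]

/-- The right module `⨁ e_{v s} A`. -/
def vertexProjective (vert : Fin r → Q) : Submodule Aᵐᵒᵖ (Fin r → A) where
  carrier := {a | ∀ s, G.e (vert s) * a s = a s}
  zero_mem' := by simp
  add_mem' ha hb s := by simp [mul_add, ha s, hb s]
  smul_mem' c a ha s := by simp [← mul_assoc, ha s]

theorem isHomogeneous_vertexProjective (vert : Fin r → Q) (deg : Fin r → ℕ) :
    G.IsHomogeneous deg (G.vertexProjective vert) := by
  intro n j a ha s
  rw [component_apply, ← mul_assoc, ← shift_e_mul, ha s]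

theorem mul_mem_vertexProjective (vert : Fin r → Q) (c : Fin r → A) :
    (fun s => G.e (vert s) * c s) ∈ G.vertexProjective vert := fun s => by
  rw [← mul_assoc, G.e_mul_self]

theorem projective_pi_op (A : Type*) [Ring A] (r : ℕ) : Module.Projective Aᵐᵒᵖ (Fin r → A) := by
  let f : A ≃ₗ[Aᵐᵒᵖ] Aᵐᵒᵖ :=
    { MulOpposite.opAddEquiv with map_smul' := fun c a => by simp }
  exact Module.Projective.of_equiv (LinearEquiv.piCongrRight fun _ : Fin r => f).symm

/-- Left multiplication by the idempotents is a right-linear retraction of the free module onto this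
submodule. -/
theorem projective_vertexProjective (vert : Fin r → Q) :
    Module.Projective Aᵐᵒᵖ (G.vertexProjective vert) := by
  have := projective_pi_op A r
  let f : (Fin r → A) →ₗ[Aᵐᵒᵖ] G.vertexProjective vert :=
    { toFun := fun c => ⟨fun s => G.e (vert s) * c s, G.mul_mem_vertexProjective vert c⟩
      map_add' := fun a b => by ext s; simp [mul_add]
      map_smul' := fun a b => by ext s; simp [mul_assoc] }
  refine Module.Projective.of_split (G.vertexProjective vert).subtype f ?_
  ext a s
  exact a.2 s

variable (deg : T → ℕ) {deg' : Fin r → ℕ} {vert : Fin r → Q} {x : Fin r → T → A}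

theorem component_combination (hx : ∀ s, G.component deg (deg' s) (vert s) (x s) = x s) (n : ℕ)
    (j : Q) (a : Fin r → A) :
    G.component deg n j (combination x a) = combination x (G.component deg' n j a) := by
  ext t
  rw [component_apply, combination_apply, combination_apply, map_sum, Finset.sum_mul]
  refine Finset.sum_congr rfl fun s _ => ?_
  have h1 : G.shift (deg t) (deg' s) (x s t) = x s t := by
    conv_lhs => rw [← hx s, component_apply, shift_mul_e, shift_shift, if_pos rfl]
    exact congrFun (hx s) t
  rw [component_apply, G.shift_mul _ _ _ h1, mul_assoc]

/-- The syzygy module of the family `x`. -/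
def syzygy (vert : Fin r → Q) (x : Fin r → T → A) : Submodule Aᵐᵒᵖ (Fin r → A) :=
  G.vertexProjective vert ⊓ LinearMap.ker (combination x)

theorem isHomogeneous_syzygy (hx : ∀ s, G.component deg (deg' s) (vert s) (x s) = x s) :
    G.IsHomogeneous deg' (G.syzygy vert x) := by
  intro n j a ha
  refine ⟨G.isHomogeneous_vertexProjective vert deg' n j a ha.1, ?_⟩
  have h0 : combination x a = 0 := ha.2
  rw [SetLike.mem_coe, LinearMap.mem_ker, ← G.component_combination deg hx, h0, map_zero]

theorem mul_e_eq (hx : ∀ s, G.component deg (deg' s) (vert s) (x s) = x s) (s : Fin r) (t : T) :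
    x s t * G.e (vert s) = x s t := by
  conv_lhs => rw [← hx s, component_apply, mul_assoc, e_mul_self]
  exact congrFun (hx s) t

theorem map_vertexProjective (hx : ∀ s, G.component deg (deg' s) (vert s) (x s) = x s) :
    (G.vertexProjective vert).map (combination x) = Submodule.span Aᵐᵒᵖ (Set.range x) := by
  apply le_antisymm
  · rintro _ ⟨a, _, rfl⟩
    rw [combination_eq_sum]
    exact Submodule.sum_mem _ fun s _ => Submodule.smul_mem _ _ (Submodule.subset_span ⟨s, rfl⟩)
  · rw [Submodule.span_le]
    rintro _ ⟨s, rfl⟩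
    refine ⟨fun s' => G.e (vert s') * (Pi.single s 1 : Fin r → A) s',
      G.mul_mem_vertexProjective _ _, ?_⟩
    ext t
    rw [combination_apply, Finset.sum_eq_single s]
    · simp [G.mul_e_eq deg hx]
    · intro s' _ h; simp [h]
    · simp

/-- Rank–nullity for `combination x` on one graded piece. The image is the full piece of the span
because taking components commutes with `combination x`. -/
theorem finrank_piece_add [FiniteDimensional k A] (hx : ∀ s, G.component deg (deg' s) (vert s) (x s) = x s) (n : ℕ)
    (j : Q) :
    Module.finrank k (G.piece deg (Submodule.span Aᵐᵒᵖ (Set.range x)) n j) +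
      Module.finrank k (G.piece deg' (G.syzygy vert x) n j) =
    Module.finrank k (G.piece deg' (G.vertexProjective vert) n j) := by
  let f : (Fin r → A) →ₗ[k] (T → A) := (combination x).restrictScalars k
  let W := G.piece deg' (G.vertexProjective vert) n j
  have h1 := LinearMap.finrank_range_add_finrank_ker (f.domRestrict W)
  rw [LinearMap.range_domRestrict, LinearMap.ker_domRestrict] at h1
  have h2 : W.map f = G.piece deg (Submodule.span Aᵐᵒᵖ (Set.range x)) n j := by
    apply le_antisymm
    · rintro _ ⟨a, ha, rfl⟩
      refine ⟨?_, ?_⟩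
      · rw [← G.map_vertexProjective deg hx]
        exact ⟨a, ha.1, rfl⟩
      · refine (G.component_combination deg hx n j a).trans ?_
        rw [ha.2]; rfl
    · rintro y ⟨hy, hy2⟩
      rw [← G.map_vertexProjective deg hx] at hy
      obtain ⟨a, ha, rfl⟩ := hy
      -- A preimage need not be homogeneous, but its component in degree `n` at `j` is a preimage
      -- too.
      refine ⟨G.component deg' n j a,
        ⟨G.isHomogeneous_vertexProjective vert deg' n j a ha, ?_⟩, ?_⟩
      · exact (G.component_component deg' n n j j a).trans (by simp)
      · exact (G.component_combination deg hx n j a).symm.trans hy2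
  have h3 : (LinearMap.ker f).comap W.subtype =
      (G.piece deg' (G.syzygy vert x) n j).comap W.subtype := by
    ext ⟨a, ha⟩
    constructor
    · intro h; exact ⟨⟨ha.1, h⟩, ha.2⟩
    · intro h; exact h.1.2
  have h4 : G.piece deg' (G.syzygy vert x) n j ≤ W := fun a ha => ⟨ha.1.1, ha.2⟩
  rw [h3, (Submodule.comapSubtypeEquivOfLe h4).finrank_eq, h2] at h1
  exact h1

/-- The degree `n` part of `e_i A e_j`. -/
noncomputable def peirce (i j : Q) (n : ℕ) : Submodule k A :=
  LinearMap.eqLocus (LinearMap.mulLeft k (G.e i)) LinearMap.id ⊓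
    LinearMap.eqLocus (LinearMap.mulRight k (G.e j) ∘ₗ G.π n) LinearMap.id

theorem mem_peirce {i j : Q} {n : ℕ} {y : A} :
    y ∈ G.peirce i j n ↔ G.e i * y = y ∧ G.π n y * G.e j = y := Iff.rfl

/-- The Hilbert series of `e_i A e_j`. -/
noncomputable def cartan (i j : Q) : PowerSeries ℤ :=
  PowerSeries.mk fun n => (Module.finrank k (G.peirce i j n) : ℤ)

end Presentation

/-! ### Hilbert series, minimal generators and vanishing syzygies -/

section

variable {k A Q : Type*} [Field k] [Ring A] [Algebra k A] [Fintype Q] [DecidableEq Q]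
  (G : VertexGrading k A Q) {T : Type*} {r : ℕ}

/-- The span over `ℤ[q]` of the rows of the matrix of Hilbert series of the `e_i A e_j`. -/
noncomputable def cartanSpan : Submodule ℤ[X] (Q → PowerSeries ℤ) :=
  Submodule.span ℤ[X] (Set.range G.cartan)

theorem finrank_piece_vertexProjective [FiniteDimensional k A] (deg : Fin r → ℕ)
    (vert : Fin r → Q) (n : ℕ) (j : Q) :
    Module.finrank k (G.piece deg (G.vertexProjective vert) n j) =
      ∑ s, if deg s ≤ n then Module.finrank k (G.peirce (vert s) j (n - deg s)) else 0 := by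
  -- The value `⊥` for `n < deg s` is needed, since the truncated difference `n - deg s` would give
  -- degree 0.
  let W : Fin r → Submodule k A := fun s =>
    if deg s ≤ n then G.peirce (vert s) j (n - deg s) else ⊥
  have hW : ∀ s y, y ∈ W s ↔ G.e (vert s) * y = y ∧ G.shift (deg s) n y * G.e j = y := by
    intro s y
    simp only [W, shift_apply]
    split_ifs
    · exact G.mem_peirce
    · rw [Submodule.mem_bot, zero_mul]
      constructor
      · rintro rfl; simp
      · exact fun h => h.2.symm
  let f : G.piece deg (G.vertexProjective vert) n j ≃ₗ[k] ((s : Fin r) → W s) :=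
    { toFun := fun a s => ⟨a.1 s, (hW s _).2 ⟨a.2.1 s, congrFun a.2.2 s⟩⟩
      map_add' := fun a b => rfl
      map_smul' := fun c a => rfl
      invFun := fun b => ⟨fun s => b s, fun s => ((hW s _).1 (b s).2).1,
        funext fun s => ((hW s _).1 (b s).2).2⟩
      left_inv := fun a => rfl
      right_inv := fun b => rfl }
  rw [f.finrank_eq, Module.finrank_pi_fintype]
  refine Finset.sum_congr rfl fun s _ => ?_
  by_cases h : deg s ≤ n
  · rw [if_pos h, show W s = _ from if_pos h]
  · rw [if_neg h, show W s = ⊥ from if_neg h, finrank_bot]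

theorem hilbertSeries_vertexProjective_mem [FiniteDimensional k A] (deg : Fin r → ℕ)
    (vert : Fin r → Q) : G.hilbertSeries deg (G.vertexProjective vert) ∈ G.cartanSpan := by
  have : G.hilbertSeries deg (G.vertexProjective vert) =
      ∑ s, (X ^ deg s : ℤ[X]) • G.cartan (vert s) := by
    ext j n
    rw [Finset.sum_apply, map_sum, hilbertSeries, PowerSeries.coeff_mk,
      finrank_piece_vertexProjective, Nat.cast_sum]
    refine Finset.sum_congr rfl fun s _ => ?_
    rw [Pi.smul_apply, Algebra.smul_def, PowerSeries.algebraMap_apply']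
    simp only [Algebra.algebraMap_self, PowerSeries.map_id, id_eq, Polynomial.coe_pow, Polynomial.coe_X,
      PowerSeries.coeff_X_pow_mul', cartan, PowerSeries.coeff_mk]
    split_ifs <;> simp
  rw [this]
  exact Submodule.sum_mem _ fun s _ => Submodule.smul_mem _ _ (Submodule.subset_span ⟨_, rfl⟩)

variable (deg : T → ℕ)

/-- `M` is finite-dimensional over `k`; the homogeneous components of a finite spanning set stay in
`M` and generate it. -/
theorem exists_homogeneous_generators [FiniteDimensional k A] [Finite T]
    {M : Submodule Aᵐᵒᵖ (T → A)} (hM : G.IsHomogeneous deg M) :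
    ∃ (r : ℕ) (x : Fin r → T → A) (deg' : Fin r → ℕ) (vert : Fin r → Q),
      (∀ s, G.component deg (deg' s) (vert s) (x s) = x s) ∧
        Submodule.span Aᵐᵒᵖ (Set.range x) = M := by
  obtain ⟨S, hS⟩ := IsNoetherian.noetherian (M.restrictScalars k)
  have hSM : ∀ m ∈ S, m ∈ M := fun m hm => by
    have : m ∈ M.restrictScalars k := by rw [← hS]; exact Submodule.subset_span hm
    exact this
  obtain ⟨N, hN⟩ := G.exists_sum_component (deg := deg)
  let ι := S × Fin N × Q
  let g := (Fintype.equivFin ι).symm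
  let y : ι → T → A := fun p => G.component deg p.2.1 p.2.2 p.1.1
  refine ⟨Fintype.card ι, y ∘ g, fun s => (g s).2.1, fun s => (g s).2.2, fun s => ?_, ?_⟩
  · exact (G.component_component deg _ _ _ _ _).trans (if_pos ⟨rfl, rfl⟩)
  · rw [g.surjective.range_comp]
    apply le_antisymm
    · rw [Submodule.span_le]
      rintro _ ⟨p, rfl⟩
      exact hM _ _ _ (hSM _ p.1.2)
    · have h1 : (S : Set (T → A)) ⊆ Submodule.span Aᵐᵒᵖ (Set.range y) := by
        intro m hm
        rw [SetLike.mem_coe, ← hN m]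
        refine Submodule.sum_mem _ fun n hn => Submodule.sum_mem _ fun j _ =>
          Submodule.subset_span ⟨(⟨m, hm⟩, ⟨n, Finset.mem_range.1 hn⟩, j), rfl⟩
      intro m hm
      have h2 : m ∈ Submodule.span k (S : Set (T → A)) := by rw [hS]; exact hm
      exact Submodule.span_le.2 h1 (Submodule.span_subset_span k Aᵐᵒᵖ _ h2)

/-- Take the least possible number of homogeneous generators. A syzygy with a nonzero degree 0 part
in some coordinate would make that generator redundant, because such a part is a nonzero multiple of
an idempotent. -/
theorem exists_minimal_generators [FiniteDimensional k A] [Finite T]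
    {M : Submodule Aᵐᵒᵖ (T → A)} (hM : G.IsHomogeneous deg M) :
    ∃ (r : ℕ) (x : Fin r → T → A) (deg' : Fin r → ℕ) (vert : Fin r → Q),
      (∀ s, G.component deg (deg' s) (vert s) (x s) = x s) ∧
        Submodule.span Aᵐᵒᵖ (Set.range x) = M ∧
          ∀ a ∈ G.syzygy vert x, ∀ s, G.π 0 (a s) = 0 := by
  classical
  have hex := G.exists_homogeneous_generators deg hM
  obtain ⟨x, deg', vert, hx, hspan⟩ := Nat.find_spec hex
  refine ⟨Nat.find hex, x, deg', vert, hx, hspan, fun a ha t => ?_⟩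
  by_contra hne
  generalize hr : Nat.find hex = r at x deg' vert a t
  obtain _ | r := r
  · exact t.elim0
  refine Nat.find_min hex (m := r) (by omega)
    ⟨x ∘ t.succAbove, deg' ∘ t.succAbove, vert ∘ t.succAbove, fun s => hx _, ?_⟩
  rw [← hspan]
  apply le_antisymm (Submodule.span_mono (Set.range_comp_subset_range _ _))
  rw [Submodule.span_le]
  rintro _ ⟨s, rfl⟩
  obtain rfl | ⟨s, rfl⟩ := t.eq_self_or_eq_succAbove s
  swap
  · exact Submodule.subset_span ⟨s, rfl⟩
  obtain ⟨c, hc⟩ := G.proj_zero (a s) (vert s) (ha.1 s)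
  have hc0 : c ≠ 0 := by rintro rfl; exact hne (by rw [hc, zero_smul])
  -- The component of the syzygy in degree `deg' s` at `vert s` is again a syzygy, and its
  -- coordinate at `s` is exactly `c • e`; the relation can be solved for `x s`.
  have hb := (G.isHomogeneous_syzygy deg hx (deg' s) (vert s) a ha).2
  rw [SetLike.mem_coe, LinearMap.mem_ker, combination_eq_sum, Fin.sum_univ_succAbove _ s] at hb
  have h1 : MulOpposite.op (G.component deg' (deg' s) (vert s) a s) • x s = c • x s := by
    ext t
    rw [component_apply, shift_apply, if_pos le_rfl, Nat.sub_self, hc, smul_mul_assoc,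
      e_mul_self, Pi.smul_apply, op_smul_eq_mul, mul_smul_comm,
      G.mul_e_eq deg hx, Pi.smul_apply]
  rw [h1, add_eq_zero_iff_eq_neg] at hb
  have h2 : x s = c⁻¹ • (c • x s) := by rw [smul_smul, inv_mul_cancel₀ hc0, one_smul]
  rw [SetLike.mem_coe, h2, hb]
  refine Submodule.smul_of_tower_mem _ _ (Submodule.neg_mem _ (Submodule.sum_mem _ fun i _ => ?_))
  exact Submodule.smul_mem _ _ (Submodule.subset_span ⟨i, rfl⟩)

/-- The surjection of `⨁ e_{v s} A` onto the submodule generated by the family `x`. -/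
def cover {deg' : Fin r → ℕ} {vert : Fin r → Q} {x : Fin r → T → A}
    (hx : ∀ s, G.component deg (deg' s) (vert s) (x s) = x s) :
    G.vertexProjective vert →ₗ[Aᵐᵒᵖ] Submodule.span Aᵐᵒᵖ (Set.range x) :=
  ((combination x).domRestrict _).codRestrict _ fun a => by
    rw [← G.map_vertexProjective deg hx]
    exact ⟨a.1, a.2, rfl⟩

theorem cover_surjective {deg' : Fin r → ℕ} {vert : Fin r → Q} {x : Fin r → T → A}
    (hx : ∀ s, G.component deg (deg' s) (vert s) (x s) = x s) :
    Function.Surjective (G.cover deg hx) := by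
  rintro ⟨y, hy⟩
  have hy' := hy
  rw [← G.map_vertexProjective deg hx] at hy'
  obtain ⟨a, ha, rfl⟩ := hy'
  exact ⟨⟨a, ha⟩, rfl⟩

theorem cover_eq_zero_iff {deg' : Fin r → ℕ} {vert : Fin r → Q} {x : Fin r → T → A}
    (hx : ∀ s, G.component deg (deg' s) (vert s) (x s) = x s) (a : G.vertexProjective vert) :
    G.cover deg hx a = 0 ↔ a.1 ∈ G.syzygy vert x :=
  ⟨fun h => ⟨a.2, congrArg Subtype.val h⟩, fun h => Subtype.ext h.2⟩

/-- A section of the cover, not necessarily graded, makes the syzygy `Ω` a direct summand of the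
covering projective `P`. By minimality `Ω` lies in the positive-degree part of `P`, so retracting
gives `Ω ⊆ Ω · A₊`. Iterating pushes `Ω` into arbitrarily high degrees, where `A` vanishes. -/
theorem syzygy_eq_bot {deg' : Fin r → ℕ} {vert : Fin r → Q} {x : Fin r → T → A}
    (hx : ∀ s, G.component deg (deg' s) (vert s) (x s) = x s)
    (hmin : ∀ a ∈ G.syzygy vert x, ∀ s, G.π 0 (a s) = 0)
    (hproj : Module.Projective Aᵐᵒᵖ (Submodule.span Aᵐᵒᵖ (Set.range x))) :
    G.syzygy vert x = ⊥ := by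
  obtain ⟨g, hg⟩ := Module.projective_lifting_property (G.cover deg hx) LinearMap.id
    (G.cover_surjective deg hx)
  -- `ρ` is the retraction of the covering projective onto the syzygy.
  let ρ : G.vertexProjective vert →ₗ[Aᵐᵒᵖ] G.vertexProjective vert :=
    LinearMap.id - g ∘ₗ G.cover deg hx
  have hρ : ∀ a, (ρ a).1 ∈ G.syzygy vert x := fun a => by
    rw [← G.cover_eq_zero_iff deg hx]
    have := LinearMap.congr_fun hg (G.cover deg hx a)
    simp only [LinearMap.comp_apply, LinearMap.id_apply] at this
    simp only [ρ, LinearMap.sub_apply, LinearMap.id_apply, LinearMap.comp_apply, map_sub]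
    rw [this, sub_self]
  have hρ' : ∀ a : G.vertexProjective vert, a.1 ∈ G.syzygy vert x → ρ a = a := fun a ha => by
    rw [← G.cover_eq_zero_iff deg hx] at ha
    simp [ρ, ha]
  let E : Fin r → G.vertexProjective vert := fun t =>
    ⟨_, G.mul_mem_vertexProjective vert (Pi.single t 1)⟩
  -- Degrees here are those of `A` in each coordinate, without the shifts. The step writes `a = ρ a
  -- = ∑ ρ (E t) * a t`: the factors `ρ (E t)` are syzygies, so they vanish below degree `m`, and `a
  -- t` has no degree 0 part.
  have key : ∀ m, ∀ a ∈ G.syzygy vert x, ∀ s, ∀ n < m, G.π n (a s) = 0 := by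
    intro m
    induction m with
    | zero => intro a _ s n hn; exact absurd hn (Nat.not_lt_zero n)
    | succ m ih =>
      intro a ha s n hn
      let α : G.vertexProjective vert := ⟨a, ha.1⟩
      have h1 : α = ∑ t, MulOpposite.op (a t) • E t := by
        ext s
        simp only [AddSubmonoidClass.coe_finsetSum, Finset.sum_apply, Submodule.coe_smul,
          Pi.smul_apply, op_smul_eq_mul, E]
        rw [Finset.sum_eq_single s]
        · simp [α, ha.1 s]
        · intro t _ hts; simp [Ne.symm hts]
        · simp
      have h2 : a s = ∑ t, (ρ (E t)).1 s * a t := by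
        have h3 := hρ' α ha
        rw [h1, map_sum, ← h1] at h3
        have h4 := congrFun (congrArg Subtype.val h3) s
        simp only [map_smul, AddSubmonoidClass.coe_finsetSum, Finset.sum_apply,
          Submodule.coe_smul, Pi.smul_apply, op_smul_eq_mul] at h4
        exact h4.symm
      rw [h2, map_sum]
      exact Finset.sum_eq_zero fun t _ =>
        G.proj_mul_eq_zero (ih _ (hρ (E t)) s) (hmin a ha t) n hn
  rw [eq_bot_iff]
  intro a ha
  rw [Submodule.mem_bot]
  ext s
  exact G.proj_eq_zero_of_forall fun n => key (n + 1) a ha s n (Nat.lt_succ_self n)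

theorem hilbertSeries_span_add_syzygy [FiniteDimensional k A] [Finite T] {deg' : Fin r → ℕ}
    {vert : Fin r → Q} {x : Fin r → T → A}
    (hx : ∀ s, G.component deg (deg' s) (vert s) (x s) = x s) :
    G.hilbertSeries deg (Submodule.span Aᵐᵒᵖ (Set.range x)) +
      G.hilbertSeries deg' (G.syzygy vert x) =
        G.hilbertSeries deg' (G.vertexProjective vert) := by
  ext j n
  simp only [Pi.add_apply, map_add, hilbertSeries, PowerSeries.coeff_mk]
  exact_mod_cast G.finrank_piece_add deg hx n j

theorem hilbertSeries_bot : G.hilbertSeries deg ⊥ = 0 := by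
  ext j n
  have : G.piece deg ⊥ n j = ⊥ := by
    rw [eq_bot_iff]; exact fun a ha => ha.1
  rw [hilbertSeries, PowerSeries.coeff_mk, this, finrank_bot]
  rfl

end

/-! ### Induction on the projective dimension -/

section Homological

open CategoryTheory

variable {k : Type*} {A : Type u} {Q : Type*} [Field k] [Ring A] [Algebra k A] [Fintype Q]
  [DecidableEq Q] (G : VertexGrading k A Q)

/-- Dimension shifting along the short exact sequence from the syzygy through its projective cover
term to the span. -/
theorem hasProjectiveDimensionLT_syzygy {T : Type} {r : ℕ} (deg : T → ℕ) {deg' : Fin r → ℕ}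
    {vert : Fin r → Q} {x : Fin r → T → A}
    (hx : ∀ s, G.component deg (deg' s) (vert s) (x s) = x s) (d : ℕ)
    (h : HasProjectiveDimensionLT (ModuleCat.of Aᵐᵒᵖ (Submodule.span Aᵐᵒᵖ (Set.range x)))
      (d + 2)) :
    HasProjectiveDimensionLT (ModuleCat.of Aᵐᵒᵖ (G.syzygy vert x)) (d + 1) := by
  have hle : G.syzygy vert x ≤ G.vertexProjective vert := inf_le_left
  let S : ShortComplex (ModuleCat.{u} Aᵐᵒᵖ) :=
    ShortComplex.mk (ModuleCat.ofHom (Submodule.inclusion hle))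
      (ModuleCat.ofHom (G.cover deg hx)) (by
        ext a t
        exact congrFun (congrArg Subtype.val
          ((G.cover_eq_zero_iff deg hx (Submodule.inclusion hle a)).2 a.2)) t)
  have hS : S.ShortExact :=
    { exact := by
        rw [ShortComplex.moduleCat_exact_iff]
        intro a ha
        exact ⟨⟨a.1, (G.cover_eq_zero_iff deg hx a).1 ha⟩, rfl⟩
      mono_f := (ModuleCat.mono_iff_injective _).2 (Submodule.inclusion_injective hle)
      epi_g := (ModuleCat.epi_iff_surjective _).2 (G.cover_surjective deg hx) }
  have hP : Projective S.X₂ :=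
    (IsProjective.iff_projective _).1 (G.projective_vertexProjective vert)
  exact (hS.hasProjectiveDimensionLT_X₃_iff d hP).1 h

/-- `HasProjectiveDimensionLT _ (d + 1)` means projective dimension at most `d`, so the induction
starts at projective modules. -/
theorem hilbertSeries_mem_cartanSpan [FiniteDimensional k A] (d : ℕ) : ∀ {r : ℕ} (deg : Fin r → ℕ)
    (M : Submodule Aᵐᵒᵖ (Fin r → A)), G.IsHomogeneous deg M →
      HasProjectiveDimensionLT (ModuleCat.of Aᵐᵒᵖ M) (d + 1) →
        G.hilbertSeries deg M ∈ G.cartanSpan := by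
  induction d with
  | zero =>
    intro r deg M hM h
    obtain ⟨r', x, deg', vert, hx, rfl, hmin⟩ := G.exists_minimal_generators deg hM
    have hproj : Module.Projective Aᵐᵒᵖ (Submodule.span Aᵐᵒᵖ (Set.range x)) :=
      (IsProjective.iff_projective _).2 (projective_iff_hasProjectiveDimensionLT_one.2 h)
    have h1 := G.hilbertSeries_span_add_syzygy deg hx
    rw [G.syzygy_eq_bot deg hx hmin hproj, hilbertSeries_bot, add_zero] at h1
    rw [h1]
    exact G.hilbertSeries_vertexProjective_mem deg' vert
  | succ d ih =>
    intro r deg M hM h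
    -- Any homogeneous generators serve here; minimality matters only in the projective case.
    obtain ⟨r', x, deg', vert, hx, rfl⟩ := G.exists_homogeneous_generators deg hM
    rw [eq_sub_of_add_eq (G.hilbertSeries_span_add_syzygy deg hx)]
    exact Submodule.sub_mem _ (G.hilbertSeries_vertexProjective_mem deg' vert)
      (ih deg' _ (G.isHomogeneous_syzygy deg hx)
        (G.hasProjectiveDimensionLT_syzygy deg hx d h))

end Homological

/-! ### The radical of `e_i A` and its Hilbert series -/

section Radical

variable {k A Q : Type*} [Field k] [Ring A] [Algebra k A] [Fintype Q] [DecidableEq Q]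
  (G : VertexGrading k A Q)

theorem proj_zero_mul (a b : A) : G.π 0 (a * b) = G.π 0 a * G.π 0 b := by
  obtain ⟨N, hN⟩ := G.exists_sum_proj
  have h : ∀ a, G.π 0 (a * b) = G.π 0 (G.π 0 a * b) := fun a => by
    conv_lhs => rw [← hN a, Finset.sum_mul, map_sum]
    have hz : ∀ p ∈ Finset.range N, p ≠ 0 → G.π 0 (G.π p a * b) = 0 := fun p _ hp => by
      rw [G.proj_mul, if_neg (by omega)]
    refine Finset.sum_eq_single 0 hz fun h0 => ?_
    -- `N = 0` forces `A = 0`, and then both sides vanish.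
    obtain rfl : N = 0 := by simpa using h0
    have ha := hN a
    have hπ := hN (G.π 0 a)
    rw [Finset.range_zero, Finset.sum_empty] at hπ
    rw [← hπ, zero_mul, map_zero]
  rw [h, G.proj_mul, if_pos le_rfl]

/-- The radical of the right module `e_i A`. -/
def vertexRadical (i : Q) : Submodule Aᵐᵒᵖ (Fin 1 → A) where
  carrier := {a | G.e i * a 0 = a 0 ∧ G.π 0 (a 0) = 0}
  zero_mem' := by simp
  add_mem' ha hb := ⟨by simp [mul_add, ha.1, hb.1], by simp [ha.2, hb.2]⟩
  smul_mem' c a ha := ⟨by simp [← mul_assoc, ha.1], by simp [G.proj_zero_mul, ha.2]⟩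

theorem isHomogeneous_vertexRadical (i : Q) :
    G.IsHomogeneous (fun _ => 0) (G.vertexRadical i) := by
  rintro n j a ⟨h1, h2⟩
  have h : G.component (fun _ => 0) n j a 0 = G.π n (a 0) * G.e j := by
    simp [component_apply, shift_apply]
  refine ⟨?_, ?_⟩
  · rw [h, ← mul_assoc, ← proj_e_mul, h1]
  · rw [h, G.proj_mul_e, G.proj_proj]
    split_ifs with h0
    · rw [← h0, h2, zero_mul]
    · rw [zero_mul]

/-- The idempotents are nonzero and orthogonal, and `e_i A_0` is spanned by `e_i`; thus the Cartan
matrix at `q = 0` is the identity. -/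
theorem finrank_peirce_zero (i j : Q) :
    Module.finrank k (G.peirce i j 0) = if i = j then 1 else 0 := by
  split_ifs with h
  · subst h
    have : G.peirce i i 0 = Submodule.span k {G.e i} := by
      ext y
      rw [G.mem_peirce, Submodule.mem_span_singleton]
      constructor
      · rintro ⟨h1, h2⟩
        obtain ⟨c, hc⟩ := G.proj_zero y i h1
        exact ⟨c, by rw [← h2, hc, smul_mul_assoc, e_mul_self]⟩
      · rintro ⟨c, rfl⟩
        simp [G.proj_e, e_mul_self]
    rw [this, finrank_span_singleton (G.e_ne_zero i)]
  · have : G.peirce i j 0 = ⊥ := by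
      rw [eq_bot_iff]
      rintro y ⟨h1, h2⟩
      obtain ⟨c, hc⟩ := G.proj_zero y i h1
      have h3 : G.π 0 y * G.e j = y := h2
      rw [Submodule.mem_bot, ← h3, hc, smul_mul_assoc, G.e_mul_e, if_neg h, smul_zero]
    rw [this, finrank_bot]

/-- Removing the radical's condition changes only degree 0, where `e_i A` has the single line
spanned by `e_i`; in positive degrees the condition is automatic. -/
theorem hilbertSeries_vertexRadical (i : Q) :
    G.hilbertSeries (fun _ => 0) (G.vertexRadical i) = G.cartan i - Pi.single i 1 := by
  ext j n
  have hpiece : ∀ a, a ∈ G.piece (fun _ => 0) (G.vertexRadical i) n j ↔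
      (G.e i * a 0 = a 0 ∧ G.π 0 (a 0) = 0) ∧ G.π n (a 0) * G.e j = a 0 := fun a => by
    rw [mem_piece]
    refine and_congr Iff.rfl ?_
    rw [funext_iff, Fin.forall_fin_one]
    simp [component_apply, shift_apply]
  rw [hilbertSeries, Pi.sub_apply, map_sub, PowerSeries.coeff_mk, cartan, PowerSeries.coeff_mk]
  have hs : PowerSeries.coeff n ((Pi.single i 1 : Q → PowerSeries ℤ) j) =
      if n = 0 ∧ i = j then 1 else 0 := by
    by_cases h : i = j
    · subst h; simp [PowerSeries.coeff_one]
    · simp [h]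
  rw [hs]
  obtain _ | n := n
  · have : G.piece (fun _ => 0) (G.vertexRadical i) 0 j = ⊥ := by
      rw [eq_bot_iff]
      intro a ha
      obtain ⟨⟨-, h1⟩, h2⟩ := (hpiece a).1 ha
      rw [h1, zero_mul] at h2
      rw [Submodule.mem_bot]
      ext t
      rw [Subsingleton.elim t 0, ← h2]; rfl
    rw [this, finrank_bot, finrank_peirce_zero]
    by_cases h : i = j <;> simp [h]
  · let f : G.piece (fun _ => 0) (G.vertexRadical i) (n + 1) j ≃ₗ[k] G.peirce i j (n + 1) :=
      { toFun := fun a => ⟨a.1 0, ((hpiece a).1 a.2).1.1, ((hpiece a).1 a.2).2⟩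
        map_add' := fun a b => rfl
        map_smul' := fun c a => rfl
        invFun := fun y => ⟨fun _ => y, (hpiece _).2 ⟨⟨y.2.1, by
          have h : G.π (n + 1) y * G.e j = y := y.2.2
          rw [← h, G.proj_mul_e, G.proj_proj, if_neg (by omega), zero_mul]⟩, y.2.2⟩⟩
        left_inv := fun a => by
          ext t
          rw [Subsingleton.elim t 0]
        right_inv := fun y => rfl }
    rw [f.finrank_eq]
    simp

end Radical

/-! ### Invertibility of the Cartan matrix of a graded algebra -/

open CategoryTheory

/-- The matrix of Hilbert polynomials of the `e_i A e_j` is invertible over `ℤ[q]` if the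
projective dimensions of the right modules are bounded. -/
theorem isUnit_det_of_hasProjectiveDimensionLT {k : Type*} {A : Type u} {Q : Type*} [Field k]
    [Ring A] [Algebra k A] [Fintype Q] [DecidableEq Q] (G : VertexGrading k A Q)
    [FiniteDimensional k A] (d : ℕ)
    (hd : ∀ M : ModuleCat.{u} Aᵐᵒᵖ, HasProjectiveDimensionLT M (d + 1)) (C : Matrix Q Q ℤ[X])
    (hC : ∀ i j, (C i j : PowerSeries ℤ) = G.cartan i j) : IsUnit C.det := by
  have h1 : ∀ i, (Pi.single i 1 : Q → PowerSeries ℤ) ∈ G.cartanSpan := fun i => by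
    have h2 : G.cartan i ∈ G.cartanSpan := Submodule.subset_span ⟨i, rfl⟩
    have h3 := Submodule.sub_mem _ h2 (G.hilbertSeries_mem_cartanSpan d _ _
      (G.isHomogeneous_vertexRadical i) (hd _))
    rwa [hilbertSeries_vertexRadical, sub_sub_cancel] at h3
  -- The coefficients of the basis vectors in terms of the rows form the left inverse. They are
  -- polynomials by the choice of scalars in `cartanSpan`, so the identity of power series descends
  -- to `ℤ[X]`.
  choose P hP using fun i => (Submodule.mem_span_range_iff_exists_fun ℤ[X]).1 (h1 i)
  refine Matrix.isUnit_det_of_left_inverse (B := Matrix.of P) ?_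
  ext1 i j
  apply Polynomial.coe_injective ℤ
  have h4 := congrFun (hP i) j
  rw [Finset.sum_apply] at h4
  have h5 : ((∑ l, P i l * C l j : ℤ[X]) : PowerSeries ℤ) =
      ∑ l, (P i l • G.cartan l) j := by
    rw [← Polynomial.coeToPowerSeries.ringHom_apply, map_sum]
    refine Finset.sum_congr rfl fun l _ => ?_
    rw [map_mul, Polynomial.coeToPowerSeries.ringHom_apply,
      Polynomial.coeToPowerSeries.ringHom_apply, hC, Pi.smul_apply, Algebra.smul_def,
      PowerSeries.algebraMap_apply']
    simp
  rw [Matrix.mul_apply]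
  refine h5.trans (h4.trans ?_)
  by_cases h : i = j
  · subst h; simp
  · simp [h]

end VertexGrading

/-! ### The path-length grading of the path algebra -/

namespace PathAlgebra

variable (k : Type u) [Field k] {Q : Type v} [Quiver.{w} Q]

theorem degreeProj_ofPath (n : ℕ) (p : OrientedPath Q) :
    degreeProj k n (ofPath k p) = if p.path.length = n then ofPath k p else 0 :=
  lift_ofPath k _ p

theorem degreeProj_mem_degreePart (n : ℕ) (x : PathAlgebra k Q) :
    degreeProj k n x ∈ degreePart k Q n := by
  induction x using induction k with
  | h0 => rw [map_zero]; exact Submodule.zero_mem _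
  | ha x y hx hy => rw [map_add]; exact Submodule.add_mem _ hx hy
  | hs a p =>
    rw [map_smul, degreeProj_ofPath]
    split_ifs with h
    · exact Submodule.smul_mem _ _ (Submodule.subset_span ⟨p, h, rfl⟩)
    · simp

theorem degreeProj_degreeProj (m n : ℕ) (x : PathAlgebra k Q) :
    degreeProj k m (degreeProj k n x) = if m = n then degreeProj k n x else 0 := by
  rw [degreeProj_of_mem k (degreeProj_mem_degreePart k n x)]
  simp only [eq_comm]

theorem ofPath_ne_zero (p : OrientedPath Q) : ofPath k p ≠ 0 :=
  Finsupp.single_ne_zero.2 one_ne_zero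

theorem degreeProj_vertex (i : Q) : degreeProj k 0 (vertex k i) = vertex k i :=
  (degreeProj_ofPath k 0 _).trans (if_pos rfl)

variable [DecidableEq Q]

theorem vertex_mul_vertex (i j : Q) :
    vertex k i * vertex k j = if i = j then vertex k i else 0 := by
  split_ifs with h
  · subst h
    exact ofPath_mul_comp k Quiver.Path.nil Quiver.Path.nil
  · exact ofPath_mul_of_ne k (p := ⟨i, i, Quiver.Path.nil⟩) (q := ⟨j, j, Quiver.Path.nil⟩)
      (Ne.symm h)

variable [Fintype Q]

theorem degreeProj_mul (m n : ℕ) (x y : PathAlgebra k Q) :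
    degreeProj k n (degreeProj k m x * y) =
      if m ≤ n then degreeProj k m x * degreeProj k (n - m) y else 0 := by
  induction x using induction k with
  | h0 => simp
  | ha x x' hx hx' => rw [map_add, add_mul, map_add, hx, hx']; split_ifs <;> simp [add_mul]
  | hs a p =>
    rw [map_smul, smul_mul_assoc, map_smul, degreeProj_ofPath]
    by_cases h : p.path.length = m
    · rw [if_pos h, degreeProj_ofPath_mul, h]
      split_ifs <;> simp
    · simp [h]

theorem degreeProj_mul_vertex (n : ℕ) (x : PathAlgebra k Q) (i : Q) :
    degreeProj k n (x * vertex k i) = degreeProj k n x * vertex k i := by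
  have := degreeProj_mul_ofPath k n ⟨i, i, Quiver.Path.nil⟩ x
  simpa using! this

theorem degreeProj_zero_mem_span_vertex (x : PathAlgebra k Q) :
    degreeProj k 0 x ∈ Submodule.span k (Set.range (vertex k : Q → PathAlgebra k Q)) := by
  induction x using induction k with
  | h0 => rw [map_zero]; exact Submodule.zero_mem _
  | ha x y hx hy => rw [map_add]; exact Submodule.add_mem _ hx hy
  | hs a p =>
    rw [map_smul, degreeProj_ofPath]
    split_ifs with h
    · obtain ⟨i, j, p⟩ := p
      obtain rfl := Quiver.Path.eq_of_length_zero p h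
      obtain rfl := Quiver.Path.eq_nil_of_length_zero p h
      exact Submodule.smul_mem _ _ (Submodule.subset_span ⟨i, rfl⟩)
    · simp

theorem degreeProj_zero_mul (x y : PathAlgebra k Q) :
    degreeProj k 0 (x * y) = degreeProj k 0 x * degreeProj k 0 y := by
  induction x using induction k with
  | h0 => simp
  | ha x x' hx hx' => rw [map_add, add_mul, map_add, hx, hx', add_mul]
  | hs a p =>
    rw [map_smul, smul_mul_assoc, map_smul, smul_mul_assoc, degreeProj_ofPath_mul,
      degreeProj_ofPath]
    by_cases h : p.path.length = 0 <;> simp [h]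

/-- The degree 0 projection is multiplicative and kills every arrow, so its kernel is a two-sided
ideal containing the arrow ideal. -/
theorem degreeProj_zero_of_mem_arrowIdeal {x : PathAlgebra k Q} (hx : x ∈ arrowIdeal k Q) :
    degreeProj k 0 x = 0 := by
  let f : PathAlgebra k Q →ₙ+* PathAlgebra k Q :=
    { toFun := degreeProj k 0
      map_mul' := degreeProj_zero_mul k
      map_zero' := map_zero _
      map_add' := map_add _ }
  have hf : arrowIdeal k Q ≤ TwoSidedIdeal.ker f := by
    rw [arrowIdeal, TwoSidedIdeal.span_le]
    rintro _ ⟨a, b, α, rfl⟩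
    rw [SetLike.mem_coe, TwoSidedIdeal.mem_ker]
    exact (degreeProj_ofPath k 0 _).trans (if_neg (by simp))
  exact (TwoSidedIdeal.mem_ker f).1 (hf hx)

end PathAlgebra

/-! ### The induced grading of the bound quiver algebra -/

namespace HomogeneousBoundQuiver

open PathAlgebra

variable {k : Type u} [Field k] {Q : Type v} [Quiver.{w} Q] [Fintype Q] [DecidableEq Q]
  (B : HomogeneousBoundQuiver k Q)

theorem proj_surjective : Function.Surjective B.proj :=
  (TwoSidedIdeal.span B.relations).ringCon.mk'_surjective

theorem proj_mul (x y : PathAlgebra k Q) : B.proj (x * y) = B.proj x * B.proj y :=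
  map_mul (TwoSidedIdeal.span B.relations).ringCon.mk' x y

theorem proj_one : B.proj 1 = 1 := map_one (TwoSidedIdeal.span B.relations).ringCon.mk'

/-- The projection of `A` onto its degree `n` part. -/
noncomputable def degProj (n : ℕ) : B.algebra →ₗ[k] B.algebra :=
  B.proj ∘ₗ degreeProj k n ∘ₗ
    (B.proj.exists_rightInverse_of_surjective
      (LinearMap.range_eq_top.2 B.proj_surjective)).choose

/-- The linear section used in `degProj` is arbitrary: two lifts differ by an element of `⟨I⟩`, and
homogeneity of `I` makes `⟨I⟩` stable under `degreeProj`. -/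
theorem degProj_proj (n : ℕ) (x : PathAlgebra k Q) :
    B.degProj n (B.proj x) = B.proj (degreeProj k n x) := by
  have h := (B.proj.exists_rightInverse_of_surjective
      (LinearMap.range_eq_top.2 B.proj_surjective)).choose_spec
  unfold degProj
  generalize (B.proj.exists_rightInverse_of_surjective
      (LinearMap.range_eq_top.2 B.proj_surjective)).choose = s at h ⊢
  rw [LinearMap.comp_apply, LinearMap.comp_apply, ← sub_eq_zero, ← map_sub, ← map_sub,
    B.proj_eq_zero_iff]
  refine degreeProj_mem_span k B.homogeneous ?_ n
  rw [← B.proj_eq_zero_iff, map_sub, sub_eq_zero]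
  exact LinearMap.congr_fun h (B.proj x)

/-- Admissibility enters here: `⟨I⟩ ⊆ J² ⊆ J`, and `J` has no degree 0 part, whereas a trivial path
is nonzero of degree 0. -/
theorem e_ne_zero (i : Q) : B.e i ≠ 0 := by
  intro h
  have h1 := B.admissible _ ((B.proj_eq_zero_iff _).1 h)
  have h2 : degreeProj k 0 (vertex k i) = 0 :=
    degreeProj_zero_of_mem_arrowIdeal k
      (TwoSidedIdeal.mem_asIdeal.1 (Ideal.mul_le_left h1))
  rw [degreeProj_vertex] at h2
  exact ofPath_ne_zero k _ h2

theorem exists_sum_degProj : ∃ N, ∀ x, ∑ n ∈ Finset.range N, B.degProj n x = x := by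
  obtain ⟨N, hN⟩ := B.finite_gradedPart_ne_bot.bddAbove
  refine ⟨N + 1, fun x => ?_⟩
  obtain ⟨x, rfl⟩ := B.proj_surjective x
  simp only [degProj_proj]
  induction x using induction k with
  | h0 => simp
  | ha x y hx hy => simp only [map_add, Finset.sum_add_distrib, hx, hy]
  | hs a p =>
    simp only [map_smul, ← Finset.smul_sum, degreeProj_ofPath]
    congr 1
    by_cases h : p.path.length < N + 1
    · rw [Finset.sum_eq_single p.path.length]
      · simp
      · intro n _ hn; simp [Ne.symm hn]
      · intro h'; exact absurd (Finset.mem_range.2 h) h'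
    · have h0 : B.gradedPart p.path.length = ⊥ := by
        by_contra hne
        exact h (Nat.lt_succ_of_le (hN hne))
      have h1 : B.proj (ofPath k p) ∈ B.gradedPart p.path.length :=
        ⟨_, Submodule.subset_span ⟨p, rfl, rfl⟩, rfl⟩
      rw [h0, Submodule.mem_bot] at h1
      rw [h1]
      refine Finset.sum_eq_zero fun n _ => ?_
      split_ifs
      · exact h1
      · exact map_zero _

/-- The grading of `A` by path length. -/
noncomputable def vertexGrading : VertexGrading k B.algebra Q where
  e := B.e
  π := B.degProj
  e_mul_e i j := by
    rw [e, e, ← proj_mul, vertex_mul_vertex]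
    split_ifs <;> simp
  sum_e := by
    simp only [e]
    rw [← map_sum]
    exact B.proj_one
  e_ne_zero := B.e_ne_zero
  proj_e i := by rw [e, degProj_proj, degreeProj_vertex]
  proj_proj m n x := by
    obtain ⟨x, rfl⟩ := B.proj_surjective x
    rw [degProj_proj, degProj_proj, degreeProj_degreeProj]
    split_ifs <;> simp
  exists_sum_proj := B.exists_sum_degProj
  proj_mul m n x y := by
    obtain ⟨x, rfl⟩ := B.proj_surjective x
    obtain ⟨y, rfl⟩ := B.proj_surjective y
    rw [degProj_proj, ← proj_mul, degProj_proj, degreeProj_mul, degProj_proj]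
    split_ifs <;> simp [proj_mul]
  proj_mul_e n x i := by
    obtain ⟨x, rfl⟩ := B.proj_surjective x
    rw [e, ← proj_mul, degProj_proj, degProj_proj, degreeProj_mul_vertex, proj_mul]
  proj_zero x i hx := by
    obtain ⟨x, rfl⟩ := B.proj_surjective x
    obtain ⟨c, hc⟩ := (Submodule.mem_span_range_iff_exists_fun k).1
      (degreeProj_zero_mem_span_vertex k x)
    refine ⟨c i, ?_⟩
    rw [← hx, e, ← proj_mul, degProj_proj, degreeProj_zero_mul, degreeProj_vertex, ← hc,
      Finset.mul_sum, Finset.sum_eq_single i, mul_smul_comm, vertex_mul_vertex, if_pos rfl,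
      map_smul]
    · intro j _ hj
      rw [mul_smul_comm, vertex_mul_vertex, if_neg (Ne.symm hj), smul_zero]
    · simp

theorem mem_gradedPart {n : ℕ} {x : B.algebra} : x ∈ B.gradedPart n ↔ B.degProj n x = x := by
  constructor
  · rintro ⟨x, hx, rfl⟩
    rw [degProj_proj, degreeProj_of_mem k hx, if_pos rfl]
  · intro h
    obtain ⟨x, rfl⟩ := B.proj_surjective x
    rw [← h, degProj_proj]
    exact ⟨_, degreeProj_mem_degreePart k n x, rfl⟩

/-- The image description and the fixed-point description agree because `e_i` and `e_j` are
idempotents of degree 0 and the degree projection is idempotent. -/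
theorem peirceGradedPart_eq (i j : Q) (n : ℕ) :
    B.peirceGradedPart i j n = B.vertexGrading.peirce i j n := by
  let G := B.vertexGrading
  ext y
  constructor
  · rintro ⟨x, hx, rfl⟩
    have hx' : G.π n x = x := B.mem_gradedPart.1 hx
    change G.e i * (x * G.e j) ∈ G.peirce i j n
    rw [G.mem_peirce, ← mul_assoc, G.e_mul_self, G.proj_e_mul, G.proj_mul_e, hx',
      mul_assoc, mul_assoc, G.e_mul_self]
    exact ⟨rfl, rfl⟩
  · rintro ⟨h1, h2⟩
    have h1' : G.e i * y = y := h1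
    have h2' : G.π n y * G.e j = y := h2
    refine ⟨G.π n y, B.mem_gradedPart.2 ?_, ?_⟩
    · exact (G.proj_proj n n y).trans (if_pos rfl)
    · change G.e i * (G.π n y * G.e j) = y
      rw [h2', h1']

theorem coe_qCartanMatrix (i j : Q) :
    (B.qCartanMatrix i j : PowerSeries ℤ) = B.vertexGrading.cartan i j := by
  ext n
  rw [Polynomial.coeff_coe, coeff_qCartanMatrix, peirceGradedPart_eq,
    VertexGrading.cartan, PowerSeries.coeff_mk]

end HomogeneousBoundQuiver

/-! ### Finite global dimension, units of `ℤ[q]`, and the theorem -/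

open CategoryTheory in
theorem exists_hasProjectiveDimensionLT_of_rightGlobalDimension_lt_top {A : Type u} [Ring A]
    (h : rightGlobalDimension A < ⊤) :
    ∃ d : ℕ, ∀ M : ModuleCat.{u} Aᵐᵒᵖ, HasProjectiveDimensionLT M (d + 1) := by
  have h1 : ∃ d : ℕ, rightGlobalDimension A ≤ (d : WithBot ℕ∞) := by
    generalize rightGlobalDimension A = g at h
    induction g using WithBot.recBotCoe with
    -- The supremum is `⊥` when all modules are zero; any bound then works.
    | bot => exact ⟨0, bot_le⟩
    | coe g =>
      induction g using ENat.recTopCoe with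
      | top => exact absurd h (lt_irrefl _)
      | coe d => exact ⟨d, le_rfl⟩
  obtain ⟨d, hd⟩ := h1
  exact ⟨d, fun M => (projectiveDimension_le_iff M d).1 ((le_iSup _ M).trans hd)⟩

theorem Polynomial.isUnit_int_iff {p : ℤ[X]} : IsUnit p ↔ p = 1 ∨ p = -1 := by
  constructor
  · intro h
    obtain ⟨r, hr, rfl⟩ := Polynomial.isUnit_iff.1 h
    obtain rfl | rfl := Int.isUnit_iff.1 hr
    · simp
    · simp
  · rintro (rfl | rfl)
    · exact isUnit_one
    · exact isUnit_one.neg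

theorem Matrix.GeneralLinearGroup.range_coe_int_polynomial (Q : Type*) [Fintype Q]
    [DecidableEq Q] :
    Set.range ((↑) : Matrix.GeneralLinearGroup Q ℤ[X] → Matrix Q Q ℤ[X]) =
      {M | M.det = 1 ∨ M.det = -1} := by
  ext M
  rw [Set.mem_ofPred_eq, ← Polynomial.isUnit_int_iff, ← Matrix.isUnit_iff_isUnit_det]
  exact Iff.rfl

theorem mainTheorem4 {k : Type u} [Field k] [IsAlgClosed k]
    {Q : Type v} [Quiver.{w} Q] [Fintype Q] [DecidableEq Q] [∀ a b : Q, Finite (a ⟶ b)]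
    (hQ : Quiver.IsConnected Q) (B : HomogeneousBoundQuiver k Q)
    (hgl : rightGlobalDimension B.algebra < ⊤) :
    (B.qCartanMatrix.det = 1 ∨ B.qCartanMatrix.det = -1) ∧
      B.qCartanMatrix ∈ Set.range ((↑) : Matrix.GeneralLinearGroup Q ℤ[X] → Matrix Q Q ℤ[X]) ∧
      Set.range ((↑) : Matrix.GeneralLinearGroup Q ℤ[X] → Matrix Q Q ℤ[X]) =
        {M | M.det = 1 ∨ M.det = -1} := by
  obtain ⟨d, hd⟩ := exists_hasProjectiveDimensionLT_of_rightGlobalDimension_lt_top hgl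
  have := B.finiteDimensional
  have h := Polynomial.isUnit_int_iff.1
    (B.vertexGrading.isUnit_det_of_hasProjectiveDimensionLT d hd B.qCartanMatrix
      B.coe_qCartanMatrix)
  have hr := Matrix.GeneralLinearGroup.range_coe_int_polynomial Q
  exact ⟨h, hr ▸ h, hr⟩
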